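/- Let $d\ge 1$ and let $\mu$ be a probability measure on $\mathbb Z^d=\mathbb Z^{d-1}\times\mathbb Z$. Let $Z(t)=(X(t),Y(t))$ be the random walk on $\mathbb Z^d$ with transition probabilities $p(z,z')=\mu(z'-z)$, where $Y(t)\in\mathbb Z$ is the last coordinate, and put $$\varphi(\alpha,\beta)=\sum_{(x,y)\in\mathbb Z^{d-1}\times\mathbb Z}\mu(x,y)\,e^{\alpha\cdot x+\beta y},\qquad \alpha\in\mathbb R^{d-1},\ \beta\in\mathbb R .$$ Assume the following condition (A): the Markov chain $Z(t)$ is irreducible on $\mathbb Z^d$; its mean $\sum_{z}z\,\mu(z)$ is not zero; $Y(t)$ is an aperiodic random walk on $\mathbb Z$ (every state has period $1$); and $\varphi$ is finite everywhere on $\mathbb R^{d}$. Let $\mathbb N^*=\{1,2,\dots\}$ and let $Z_+(t)=(X_+(t),Y_+(t))$ be the walk $Z(t)$ killed when it leaves $\mathbb Z^{d-1}\times\mathbb N^*$, that is, the substochastic Markov chain on $\mathbb Z^{d-1}\times\mathbb N^*$ with transition matrix $(\mu(z'-z))_{z,z'\in\mathbb Z^{d-1}\times\mathbb N^*}$. For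 $\alpha\in\mathbb R^{d-1}$, define its Feynman–Kac transform matrix $\mathcal P_+(\alpha)$ by $$\mathcal P_+(\alpha,y,y')=\mathbb E_{(0,y)}\bigl(e^{\alpha\cdot X_+(1)};\,Y_+(1)=y'\bigr),\qquad y,y'\in\mathbb N^*,$$ and let $\mathcal P_+^{(n)}(\alpha,y,y')$ denote the entries of its $n$-th power. Then for every $\alpha\in\mathbb R^{d-1}$ the logarithm of the spectral radius of $\mathcal P_+(\alpha)$, $$\lambda_+(\alpha)=\limsup_{n\to\infty}\frac1n\log\mathcal P_+^{(n)}(\alpha,y,y'),$$ satisfies, for all $y,y'\in\mathbb N^*$ (so that it does not depend on $y,y'$), $$\lambda_+(\alpha)=\inf_{\beta\in\mathbb R}\log\varphi(\alpha,\beta).$$ -/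

import Mathlib

open scoped ENNReal

noncomputable section

namespace KilledWalk

/-- The `n`-th power of a (possibly infinite) matrix with entries in `[0, ∞]`. For the transition
matrix of a (sub)stochastic Markov chain, `matPow P n s t` is the `n`-step transition
probability from `s` to `t`. -/
def matPow {S : Type*} (P : S → S → ℝ≥0∞) : ℕ → S → S → ℝ≥0∞
  | 0, s, t => by classical exact if s = t then 1 else 0
  | n + 1, s, t => ∑' u, matPow P n s u * P u t

/-- Irreducibility of a chain: every state can be reached from every state. -/
def IsIrreducible {S : Type*} (P : S → S → ℝ≥0∞) : Prop :=
  ∀ s t, ∃ n, 0 < matPow P n s t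

/-- Aperiodicity of a chain: every state has period one. -/
def IsAperiodic {S : Type*} (P : S → S → ℝ≥0∞) : Prop :=
  ∀ s, Nat.setGcd {n | 0 < n ∧ 0 < matPow P n s s} = 1

/-- Transition matrix of the homogeneous random walk with step distribution `ν`. -/
def walk {G : Type*} [AddGroup G] (ν : PMF G) : G → G → ℝ≥0∞ :=
  fun z z' => ν (z' - z)

/-- Law of the steps of the last coordinate. A point of `ℤ^d`, `d = k + 1`, is written `(x, y)`
with `x ∈ ℤ^k` and `y ∈ ℤ`. -/
def lastStep {k : ℕ} (μ : PMF ((Fin k → ℤ) × ℤ)) : PMF ℤ := μ.map Prod.snd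

/-- The mean `∑ z, μ(z) z` of the step distribution, a vector of `ℝ^(k+1)`. -/
def mean {k : ℕ} (μ : PMF ((Fin k → ℤ) × ℤ)) : (Fin k → ℝ) × ℝ :=
  ∑' z : (Fin k → ℤ) × ℤ, (μ z).toReal • ((fun i => (z.1 i : ℝ)), (z.2 : ℝ))

/-- The jump generating function `φ(α, β) = ∑ μ(x, y) exp(α ⬝ x + β y)`, with values
in `[0, ∞]`. -/
def jumpGen {k : ℕ} (μ : PMF ((Fin k → ℤ) × ℤ)) (α : Fin k → ℝ) (β : ℝ) : ℝ≥0∞ :=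
  ∑' z : (Fin k → ℤ) × ℤ,
    μ z * ENNReal.ofReal (Real.exp ((∑ i, α i * (z.1 i : ℝ)) + β * (z.2 : ℝ)))

/-- The standing hypotheses on the step distribution: the walk is irreducible on `ℤ^(k+1)`, its
mean is not zero, its last coordinate is an aperiodic walk on `ℤ`, and its jump generating
function is finite everywhere. -/
structure Hypotheses {k : ℕ} (μ : PMF ((Fin k → ℤ) × ℤ)) : Prop where
  irreducible : IsIrreducible (walk μ)
  mean_ne_zero : mean μ ≠ 0
  aperiodic : IsAperiodic (walk (lastStep μ))
  finite : ∀ (α : Fin k → ℝ) (β : ℝ), jumpGen μ α β ≠ ∞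

/-- Transition matrix of the walk killed when leaving the half-space of points with positive last
coordinate. -/
def killedWalk {k : ℕ} (μ : PMF ((Fin k → ℤ) × ℤ)) :
    (Fin k → ℤ) × ℕ+ → (Fin k → ℤ) × ℕ+ → ℝ≥0∞ :=
  fun z z' => walk μ (z.1, (z.2 : ℤ)) (z'.1, (z'.2 : ℤ))

/-- The Feynman-Kac transform matrix `E_{(0,y)} (exp(α ⬝ A(1)); M(1) = y')` of a Markov-additive
process `(A, M)` on `ℤ^k × E` with transition matrix `p`. -/
def feynmanKac {k : ℕ} {E : Type*} (p : (Fin k → ℤ) × E → (Fin k → ℤ) × E → ℝ≥0∞)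
    (α : Fin k → ℝ) : E → E → ℝ≥0∞ :=
  fun y y' => ∑' x : Fin k → ℤ,
    p (0, y) (x, y') * ENNReal.ofReal (Real.exp (∑ i, α i * (x i : ℝ)))

/-- `limsup (1/n) log P^(n)(y, y')`, in `[-∞, ∞]`: for an irreducible matrix this is the logarithm
of the spectral radius. Here `ENNReal.log 0 = -∞` and `ENNReal.log ∞ = ∞`. -/
def logSpectralRadius {E : Type*} (P : E → E → ℝ≥0∞) (y y' : E) : EReal :=
  Filter.limsup (fun n : ℕ => ENNReal.log (matPow P n y y') / (n : EReal)) Filter.atTop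

end KilledWalk

end

/-! Summing out the first coordinates turns the transform matrix into a Toeplitz matrix `a (y' - y)`
on `ℕ+`, where `∑ a j exp (β j)` is the jump generating function.

Upper bound: for each `β`, `y ↦ exp (β y)` is multiplied by `φ(α, β)` under the walk on `ℤ`, and
killing only loses mass, so `logSpectralRadius_le_log` applies.

Lower bound: irreducibility gives `a` mass at both signs, so `φ(α, ·)` attains its minimum `ρ`, at a
`β` where the tilted drift vanishes. There one step of the unkilled walk sends `exp (β y) y (2 L -
y)` to `exp (β y) (ρ y (2 L - y) - σ)`, with `σ` the tilted second moment. For `r < ρ` and `L`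
large, its positive part is a finitely supported `f ≠ 0` with `r f ≤ P f`, and
`log_le_logSpectralRadius` concludes. -/

namespace KilledWalk

open Filter Topology

/-! ### Powers of nonnegative matrices -/

section Matrix

variable {S : Type*} (P : S → S → ℝ≥0∞)

theorem matPow_zero_self (s : S) : matPow P 0 s s = 1 := by simp [matPow]

theorem matPow_one (s t : S) : matPow P 1 s t = P s t := by
  classical
  simp only [matPow]
  rw [tsum_eq_single s]
  · simp
  · intro u hu
    simp [hu.symm]

/-- The easy half of the Chapman-Kolmogorov equations. -/
theorem matPow_mul_le (m n : ℕ) (s u t : S) :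
    matPow P m s u * matPow P n u t ≤ matPow P (m + n) s t := by
  classical
  induction n generalizing t with
  | zero =>
    simp only [matPow, add_zero]
    split_ifs with h <;> simp [h]
  | succ n ih =>
    rw [← add_assoc]
    simp only [matPow]
    rw [← ENNReal.tsum_mul_left]
    refine ENNReal.tsum_le_tsum fun v => ?_
    rw [← mul_assoc]
    gcongr
    exact ih v

theorem tsum_matPow_zero (f : S → ℝ≥0∞) (s : S) : ∑' t, matPow P 0 s t * f t = f s := by
  classical
  rw [tsum_eq_single s]
  · simp [matPow]
  · intro t ht
    simp [matPow, ht.symm]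

theorem tsum_matPow_succ (f : S → ℝ≥0∞) (n : ℕ) (s : S) :
    ∑' t, matPow P (n + 1) s t * f t = ∑' u, matPow P n s u * ∑' t, P u t * f t := by
  simp only [matPow, ← ENNReal.tsum_mul_right, ← ENNReal.tsum_mul_left]
  rw [ENNReal.tsum_comm]
  simp only [mul_assoc]

theorem tsum_matPow_mul_le {f : S → ℝ≥0∞} {r : ℝ≥0∞} (h : ∀ s, ∑' t, P s t * f t ≤ r * f s)
    (n : ℕ) (s : S) : ∑' t, matPow P n s t * f t ≤ r ^ n * f s := by
  induction n with
  | zero => simp [tsum_matPow_zero]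
  | succ n ih =>
    calc ∑' t, matPow P (n + 1) s t * f t
        = ∑' u, matPow P n s u * ∑' t, P u t * f t := tsum_matPow_succ P f n s
      _ ≤ ∑' u, matPow P n s u * (r * f u) := ENNReal.tsum_le_tsum fun u => by gcongr; exact h u
      _ = r * ∑' u, matPow P n s u * f u := by
        rw [← ENNReal.tsum_mul_left]; exact tsum_congr fun u => by ring
      _ ≤ r * (r ^ n * f s) := by gcongr
      _ = r ^ (n + 1) * f s := by ring

theorem le_tsum_matPow_mul {f : S → ℝ≥0∞} {r : ℝ≥0∞} (h : ∀ s, r * f s ≤ ∑' t, P s t * f t)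
    (n : ℕ) (s : S) : r ^ n * f s ≤ ∑' t, matPow P n s t * f t := by
  induction n with
  | zero => simp [tsum_matPow_zero]
  | succ n ih =>
    calc r ^ (n + 1) * f s = r * (r ^ n * f s) := by ring
      _ ≤ r * ∑' u, matPow P n s u * f u := by gcongr
      _ = ∑' u, matPow P n s u * (r * f u) := by
        rw [← ENNReal.tsum_mul_left]; exact tsum_congr fun u => by ring
      _ ≤ ∑' u, matPow P n s u * ∑' t, P u t * f t :=
        ENNReal.tsum_le_tsum fun u => by gcongr; exact h u
      _ = ∑' t, matPow P (n + 1) s t * f t := (tsum_matPow_succ P f n s).symm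

end Matrix

/-! ### Growth rates and spectral radius bounds by test functions -/

theorem eventually_mul_pow_le {C r r' : ℝ≥0∞} (hC : C ≠ ∞) (h : r < r') :
    ∀ᶠ n : ℕ in atTop, C * r ^ n ≤ r' ^ n := by
  by_cases hr' : r' = ∞
  · filter_upwards [eventually_ge_atTop 1] with n hn
    rw [hr', ENNReal.top_pow (by omega)]
    exact le_top
  have h0 : r' ≠ 0 := (bot_le.trans_lt h).ne'
  have h1 : Tendsto (fun n : ℕ => C * (r / r') ^ n) atTop (𝓝 (C * 0)) :=
    ENNReal.Tendsto.const_mul (ENNReal.tendsto_pow_atTop_nhds_zero_of_lt_one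
      ((ENNReal.div_lt_iff (Or.inl h0) (Or.inl hr')).2 (by simpa using h))) (Or.inr hC)
  rw [mul_zero] at h1
  filter_upwards [h1.eventually (ge_mem_nhds one_pos)] with n hn
  calc C * r ^ n = C * (r / r') ^ n * r' ^ n := by
        rw [mul_assoc, ← mul_pow, ENNReal.div_mul_cancel h0 hr']
    _ ≤ 1 * r' ^ n := by gcongr
    _ = r' ^ n := one_mul _

theorem log_pow_div {r : ℝ≥0∞} {n : ℕ} (hn : n ≠ 0) :
    ENNReal.log (r ^ n) / (n : EReal) = ENNReal.log r := by
  rw [ENNReal.log_pow, mul_comm, ← EReal.mul_div_right]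
  exact EReal.div_mul_cancel (EReal.natCast_ne_bot n) (EReal.natCast_ne_top n)
    (by exact_mod_cast hn)

theorem limsup_log_div_le {u : ℕ → ℝ≥0∞} {C r : ℝ≥0∞} (hC : C ≠ ∞)
    (h : ∀ n, u n ≤ C * r ^ n) :
    limsup (fun n : ℕ => ENNReal.log (u n) / (n : EReal)) atTop ≤ ENNReal.log r := by
  -- Moving to `ℝ≥0∞` allows comparison with every `r' > r`; the gap absorbs the constant `C`.
  rw [← EReal.log_exp (limsup _ _), ENNReal.log_le_log_iff]
  refine le_of_forall_gt_imp_ge_of_dense fun r' hr' => ?_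
  rw [← ENNReal.log_le_log_iff, EReal.log_exp]
  refine limsup_le_of_le (by isBoundedDefault) ?_
  filter_upwards [eventually_mul_pow_le hC hr', eventually_ne_atTop 0] with n hn h0
  rw [← log_pow_div (r := r') h0]
  exact EReal.div_le_div_right_of_nonneg (by simp) (ENNReal.log_monotone ((h n).trans hn))

theorem le_limsup_log_div {u : ℕ → ℝ≥0∞} {c r : ℝ≥0∞} (hc : c ≠ 0)
    (h : ∃ᶠ n in atTop, c * r ^ n ≤ u n) :
    ENNReal.log r ≤ limsup (fun n : ℕ => ENNReal.log (u n) / (n : EReal)) atTop := by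
  rw [← EReal.log_exp (limsup _ _), ENNReal.log_le_log_iff]
  refine le_of_forall_lt_imp_le_of_dense fun r' hr' => ?_
  rw [← ENNReal.log_le_log_iff, EReal.log_exp]
  refine le_limsup_of_frequently_le ?_ (by isBoundedDefault)
  refine (h.and_eventually ((eventually_mul_pow_le (ENNReal.inv_ne_top.2 hc) hr').and
    (eventually_ne_atTop 0))).mono fun n hn => ?_
  obtain ⟨h1, h2, h0⟩ := hn
  rw [← log_pow_div (r := r') h0]
  refine EReal.div_le_div_right_of_nonneg (by simp) (ENNReal.log_monotone (le_trans ?_ h1))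
  rw [mul_comm, ← div_eq_mul_inv] at h2
  rw [mul_comm]
  exact (ENNReal.div_le_iff_le_mul (Or.inl hc)
    (Or.inr (pow_ne_zero _ (lt_of_le_of_lt zero_le hr').ne'))).1 h2

/-- A finitely supported function `f` with `r f ≤ P f` bounds the spectral radius of an
irreducible matrix `P` from below by `r`. -/
theorem log_le_logSpectralRadius {S : Type*} {P : S → S → ℝ≥0∞} (hP : IsIrreducible P)
    {f : S → ℝ≥0∞} {r : ℝ≥0∞} {s₀ : S} (hf : f.support.Finite) (hf_top : ∀ s, f s ≠ ∞)
    (h₀ : f s₀ ≠ 0) (hr : r ≠ 0) (hr_top : r ≠ ∞) (h : ∀ s, r * f s ≤ ∑' t, P s t * f t)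
    (s t : S) : ENNReal.log r ≤ logSpectralRadius P s t := by
  classical
  set A : Finset S := hf.toFinset with hA
  set M : ℝ≥0∞ := ∑ u ∈ A, f u with hM
  have hM_top : M ≠ ∞ := by simp [hM, hf_top]
  have key : ∀ n : ℕ, ∃ u ∈ A, f s₀ / M * r ^ n ≤ matPow P n s₀ u := by
    -- If every entry over the support were smaller, the `f`-weighted sum would fall below `r ^ n *
    -- f s₀`.
    intro n
    by_contra! hcon
    have hA_ne : A.Nonempty := ⟨s₀, by simpa [hA] using h₀⟩
    have hsum : ∑ u ∈ A, matPow P n s₀ u * f u < ∑ u ∈ A, f s₀ / M * r ^ n * f u := by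
      refine ENNReal.sum_lt_sum_of_nonempty hA_ne fun u hu => ?_
      have hu0 : f u ≠ 0 := by simpa [hA] using hu
      exact ENNReal.mul_lt_mul_left hu0 (hf_top u) (hcon u hu)
    have h1 : ∑' u, matPow P n s₀ u * f u = ∑ u ∈ A, matPow P n s₀ u * f u := by
      refine tsum_eq_sum fun u hu => ?_
      have : f u = 0 := by simpa [hA] using hu
      simp [this]
    have hM0 : M ≠ 0 := by
      intro h0
      exact h₀ ((Finset.sum_eq_zero_iff.1 h0) s₀ (by simpa [hA] using h₀))
    rw [← Finset.mul_sum, ← h1, ← hM] at hsum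
    have h2 : f s₀ / M * r ^ n * M = r ^ n * f s₀ := by
      rw [mul_right_comm, ENNReal.div_mul_cancel hM0 hM_top, mul_comm]
    rw [h2] at hsum
    exact absurd (le_tsum_matPow_mul P h n s₀) (not_le.2 hsum)
  have hfreq : ∃ᶠ n : ℕ in atTop, ∃ u ∈ A, f s₀ / M * r ^ n ≤ matPow P n s₀ u :=
    (Eventually.of_forall key).frequently
  -- Pigeonhole: the support is finite, so one `u` serves infinitely many `n`, which suffices for a
  -- limsup.
  obtain ⟨u, -, hu⟩ : ∃ u ∈ A, ∃ᶠ n : ℕ in atTop, f s₀ / M * r ^ n ≤ matPow P n s₀ u := by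
    by_contra! hcon
    refine hfreq ?_
    have := (Filter.eventually_all_finset A).2 fun u hu => hcon u hu
    filter_upwards [this] with n hn
    rintro ⟨u, hu, h⟩
    exact absurd h (not_le.2 (hn u hu))
  obtain ⟨m, hm⟩ := hP s s₀
  obtain ⟨l, hl⟩ := hP u t
  have hfM : f s₀ / M ≠ 0 := ENNReal.div_ne_zero.2 ⟨h₀, hM_top⟩
  -- Paths `s → s₀` and `u → t` are glued on; dividing by `r ^ (m + l)` pays for their extra length.
  refine le_limsup_log_div (c := matPow P m s s₀ * (f s₀ / M) * matPow P l u t / r ^ (m + l))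
    (ENNReal.div_ne_zero.2 ⟨mul_ne_zero (mul_ne_zero hm.ne' hfM) hl.ne',
      ENNReal.pow_ne_top hr_top⟩) ?_
  rw [frequently_atTop] at hu ⊢
  intro N
  obtain ⟨n, hn, hn'⟩ := hu N
  refine ⟨m + n + l, by omega, ?_⟩
  calc matPow P m s s₀ * (f s₀ / M) * matPow P l u t / r ^ (m + l) * r ^ (m + n + l)
      = matPow P m s s₀ * (f s₀ / M * r ^ n) * matPow P l u t := by
        rw [show m + n + l = (m + l) + n by ring, pow_add _ (m + l) n, ← mul_assoc,
          ENNReal.div_mul_cancel (pow_ne_zero _ hr) (ENNReal.pow_ne_top hr_top)]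
        ring
    _ ≤ matPow P m s s₀ * matPow P n s₀ u * matPow P l u t := by gcongr
    _ ≤ matPow P (m + n) s u * matPow P l u t := by gcongr; exact matPow_mul_le P m n s s₀ u
    _ ≤ matPow P (m + n + l) s t := matPow_mul_le P (m + n) l s u t

/-- A positive function `f` with `P f ≤ r f` bounds the spectral radius from above by `r`. -/
theorem logSpectralRadius_le_log {S : Type*} {P : S → S → ℝ≥0∞}
    {f : S → ℝ≥0∞} {r : ℝ≥0∞} (h : ∀ s, ∑' t, P s t * f t ≤ r * f s) {s t : S}
    (hs : f s ≠ ∞) (ht : f t ≠ 0) (ht_top : f t ≠ ∞) :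
    logSpectralRadius P s t ≤ ENNReal.log r := by
  refine limsup_log_div_le (C := f s / f t) (ENNReal.div_ne_top hs ht) fun n => ?_
  have h1 : matPow P n s t * f t ≤ r ^ n * f s :=
    (ENNReal.le_tsum t).trans (tsum_matPow_mul_le P h n s)
  calc matPow P n s t ≤ r ^ n * f s / f t :=
        (ENNReal.le_div_iff_mul_le (Or.inl ht) (Or.inl ht_top)).2 h1
    _ = f s / f t * r ^ n := by rw [mul_div_assoc, mul_comm]

end KilledWalk

namespace KilledWalk

open Filter Topology MeasureTheory ProbabilityTheory

/-! ### Zero-drift tilt and the test function -/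

section Minimizer

/-- The measure on `ℤ` with mass `a j` at `j`. -/
noncomputable def massMeasure (a : ℤ → ℝ≥0∞) : Measure ℤ :=
  Measure.sum fun j => a j • Measure.dirac j

theorem lintegral_massMeasure (a f : ℤ → ℝ≥0∞) : ∫⁻ j, f j ∂massMeasure a = ∑' j, a j * f j := by
  simp [massMeasure, lintegral_sum_measure, lintegral_smul_measure]

variable {a : ℤ → ℝ≥0∞}

theorem integrable_exp_massMeasure
    (hfin : ∀ β : ℝ, ∑' j : ℤ, a j * ENNReal.ofReal (Real.exp (β * j)) ≠ ∞) (β : ℝ) :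
    Integrable (fun j : ℤ => Real.exp (β * j)) (massMeasure a) := by
  refine ⟨by fun_prop, ?_⟩
  rw [hasFiniteIntegral_iff_ofReal (ae_of_all _ fun j => (Real.exp_pos _).le),
    lintegral_massMeasure]
  exact (hfin β).lt_top

theorem ofReal_mgf_massMeasure
    (hfin : ∀ β : ℝ, ∑' j : ℤ, a j * ENNReal.ofReal (Real.exp (β * j)) ≠ ∞) (β : ℝ) :
    ENNReal.ofReal (mgf (fun j : ℤ => (j : ℝ)) (massMeasure a) β) =
      ∑' j : ℤ, a j * ENNReal.ofReal (Real.exp (β * j)) := by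
  rw [mgf, ofReal_integral_eq_lintegral_ofReal (integrable_exp_massMeasure hfin β)
    (ae_of_all _ fun j => (Real.exp_pos _).le), lintegral_massMeasure]

/-- A single term of the series; taken with `j` of either sign it forces growth at both ends. -/
theorem mul_exp_le_mgf_massMeasure
    (hfin : ∀ β : ℝ, ∑' j : ℤ, a j * ENNReal.ofReal (Real.exp (β * j)) ≠ ∞) (j : ℤ) (β : ℝ) :
    (a j).toReal * Real.exp (β * j) ≤ mgf (fun j : ℤ => (j : ℝ)) (massMeasure a) β := by
  have h : a j * ENNReal.ofReal (Real.exp (β * j)) ≤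
      ENNReal.ofReal (mgf (fun j : ℤ => (j : ℝ)) (massMeasure a) β) := by
    rw [ofReal_mgf_massMeasure hfin]
    exact ENNReal.le_tsum (f := fun j : ℤ => a j * ENNReal.ofReal (Real.exp (β * j))) j
  have := ENNReal.toReal_mono ENNReal.ofReal_ne_top h
  rwa [ENNReal.toReal_mul, ENNReal.toReal_ofReal (Real.exp_pos _).le,
    ENNReal.toReal_ofReal mgf_nonneg] at this

theorem mass_ne_top (hfin : ∀ β : ℝ, ∑' j : ℤ, a j * ENNReal.ofReal (Real.exp (β * j)) ≠ ∞)
    (j : ℤ) : a j ≠ ∞ := by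
  have h0 := ENNReal.ne_top_of_tsum_ne_top (hfin 0) j
  simpa using h0

/-- The moment generating function has a minimizer, at which the tilted mean vanishes. -/
theorem exists_tilted_mean_eq_zero
    (hfin : ∀ β : ℝ, ∑' j : ℤ, a j * ENNReal.ofReal (Real.exp (β * j)) ≠ ∞)
    {u d : ℤ} (hu : 0 < u) (hd : d < 0) (hau : a u ≠ 0) (had : a d ≠ 0) :
    ∃ β : ℝ, ∫ j : ℤ, (j : ℝ) * Real.exp (β * j) ∂massMeasure a = 0 := by
  set φ := mgf (fun j : ℤ => (j : ℝ)) (massMeasure a) with hφ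
  have hcont : Continuous φ := continuous_mgf (integrable_exp_massMeasure hfin)
  have hpos : ∀ {j : ℤ}, a j ≠ 0 → 0 < (a j).toReal := fun h =>
    ENNReal.toReal_pos h (mass_ne_top hfin _)
  have htop : Tendsto φ atTop atTop := by
    refine tendsto_atTop_mono (mul_exp_le_mgf_massMeasure hfin u) ?_
    refine Tendsto.const_mul_atTop (hpos hau) (Real.tendsto_exp_atTop.comp ?_)
    exact tendsto_id.atTop_mul_const (by exact_mod_cast hu)
  have hbot : Tendsto φ atBot atTop := by
    refine tendsto_atTop_mono (mul_exp_le_mgf_massMeasure hfin d) ?_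
    refine Tendsto.const_mul_atTop (hpos had) (Real.tendsto_exp_atTop.comp ?_)
    exact tendsto_id.atBot_mul_const_of_neg (by exact_mod_cast hd)
  obtain ⟨β, hβ⟩ := hcont.exists_forall_le (by
    rw [cocompact_eq_atBot_atTop]
    exact hbot.sup htop)
  refine ⟨β, ?_⟩
  have hset : β ∈ interior (integrableExpSet (fun j : ℤ => (j : ℝ)) (massMeasure a)) := by
    rw [show integrableExpSet (fun j : ℤ => (j : ℝ)) (massMeasure a) = Set.univ from
      Set.eq_univ_of_forall (integrable_exp_massMeasure hfin), interior_univ]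
    trivial
  exact IsLocalMin.hasDerivAt_eq_zero (Eventually.of_forall hβ) (hasDerivAt_mgf hset)

theorem integrable_pow_mul_exp_massMeasure
    (hfin : ∀ β : ℝ, ∑' j : ℤ, a j * ENNReal.ofReal (Real.exp (β * j)) ≠ ∞) (n : ℕ) (β : ℝ) :
    Integrable (fun j : ℤ => (j : ℝ) ^ n * Real.exp (β * j)) (massMeasure a) :=
  integrable_pow_mul_exp_of_integrable_exp_mul one_ne_zero
    (integrable_exp_massMeasure hfin _) (integrable_exp_massMeasure hfin _) n

/-- The tilted parabola, which vanishes outside `(0, 2 L)`. -/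
noncomputable def tiltedParabola (β : ℝ) (L : ℕ) (y : ℤ) : ℝ≥0∞ :=
  ENNReal.ofReal (Real.exp (β * y) * ((y : ℝ) * (2 * L - y)))

theorem tiltedParabola_eq_zero {β : ℝ} {L : ℕ} {y : ℤ} (hy : y ≤ 0 ∨ 2 * (L : ℤ) ≤ y) :
    tiltedParabola β L y = 0 := by
  refine ENNReal.ofReal_of_nonpos (mul_nonpos_of_nonneg_of_nonpos (Real.exp_pos _).le ?_)
  rcases hy with hy | hy
  · have h1 : (y : ℝ) ≤ 0 := by exact_mod_cast hy
    exact mul_nonpos_of_nonpos_of_nonneg h1 (by linarith [(Nat.cast_nonneg L : (0 : ℝ) ≤ L)])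
  · have h1 : 2 * (L : ℝ) ≤ y := by exact_mod_cast hy
    exact mul_nonpos_of_nonneg_of_nonpos (by linarith [(Nat.cast_nonneg L : (0 : ℝ) ≤ L)])
      (by linarith)

/-- With zero tilted drift the linear term in `j` drops out, and the curvature costs only the
constant `σ`, negligible against the parabola for large `L`. -/
theorem exists_mul_tiltedParabola_le
    (hfin : ∀ β : ℝ, ∑' j : ℤ, a j * ENNReal.ofReal (Real.exp (β * j)) ≠ ∞) {β : ℝ}
    (hβ : ∫ j : ℤ, (j : ℝ) * Real.exp (β * j) ∂massMeasure a = 0) {r : ℝ≥0∞}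
    (hr : r < ∑' j : ℤ, a j * ENNReal.ofReal (Real.exp (β * j))) :
    ∃ L : ℕ, 0 < L ∧ ∀ y : ℤ,
      r * tiltedParabola β L y ≤ ∑' j : ℤ, a j * tiltedParabola β L (y + j) := by
  set ρ := mgf (fun j : ℤ => (j : ℝ)) (massMeasure a) β with hρ
  set σ := ∫ j : ℤ, (j : ℝ) ^ 2 * Real.exp (β * j) ∂massMeasure a with hσ
  rw [← ofReal_mgf_massMeasure hfin, ← hρ] at hr
  have hr_top : r ≠ ∞ := (hr.trans ENNReal.ofReal_lt_top).ne
  have hrρ : r.toReal < ρ := (ENNReal.lt_ofReal_iff_toReal_lt hr_top).1 hr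
  -- At integers of `(0, 2 L)` the parabola is at least `2 L - 1 ≥ L`, so `L (ρ - r) > σ` covers the
  -- loss.
  obtain ⟨L, hL⟩ := exists_nat_gt (max 1 (σ / (ρ - r.toReal)))
  have hL1 : (1 : ℝ) < L := (le_max_left _ _).trans_lt hL
  have hLσ : σ < L * (ρ - r.toReal) :=
    (div_lt_iff₀ (sub_pos.2 hrρ)).1 ((le_max_right _ _).trans_lt hL)
  refine ⟨L, by exact_mod_cast zero_lt_one.trans hL1, fun y => ?_⟩
  by_cases hy : y ≤ 0 ∨ 2 * (L : ℤ) ≤ y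
  · simp [tiltedParabola_eq_zero hy]
  push Not at hy
  have hy1 : (1 : ℝ) ≤ y := by exact_mod_cast hy.1
  have hy2 : (y : ℝ) + 1 ≤ 2 * L := by exact_mod_cast hy.2
  set q : ℝ := (y : ℝ) * (2 * L - y) with hq
  have hqL : (L : ℝ) ≤ q := by nlinarith
  let g : ℤ → ℝ := fun j => Real.exp (β * (y + j : ℤ)) * (((y + j : ℤ) : ℝ) * (2 * L - (y + j : ℤ)))
  have hg_eq : g = fun j : ℤ => Real.exp (β * y) * (q * ((j : ℝ) ^ 0 * Real.exp (β * j)) +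
      2 * (L - y) * ((j : ℝ) ^ 1 * Real.exp (β * j)) - (j : ℝ) ^ 2 * Real.exp (β * j)) := by
    funext j
    simp only [g, hq]
    push_cast
    rw [mul_add, Real.exp_add]
    ring
  have hi := fun n => integrable_pow_mul_exp_massMeasure hfin n β
  have hg_int : Integrable g (massMeasure a) := by
    rw [hg_eq]
    exact ((((hi 0).const_mul _).add ((hi 1).const_mul _)).sub (hi 2)).const_mul _
  have hg_val : ∫ j, g j ∂massMeasure a = Real.exp (β * y) * (q * ρ - σ) := by
    rw [hg_eq, integral_const_mul, integral_sub
      (by exact ((hi 0).const_mul _).add ((hi 1).const_mul _)) (hi 2), integral_add ((hi 0).const_mul _) ((hi 1).const_mul _), integral_const_mul,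
      integral_const_mul]
    simp only [pow_zero, one_mul, pow_one]
    rw [hβ, mul_zero, add_zero]
    rfl
  calc r * tiltedParabola β L y
      = ENNReal.ofReal (r.toReal * (Real.exp (β * y) * q)) := by
        rw [ENNReal.ofReal_mul ENNReal.toReal_nonneg, ENNReal.ofReal_toReal hr_top]
        rfl
    -- Truncation at zero only increases the integral.
    _ ≤ ENNReal.ofReal (∫ j, max (g j) 0 ∂massMeasure a) := by
        refine ENNReal.ofReal_le_ofReal (le_trans ?_
          (integral_mono hg_int hg_int.pos_part fun j => le_max_left _ _))
        rw [hg_val, mul_left_comm]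
        refine mul_le_mul_of_nonneg_left ?_ (Real.exp_pos _).le
        nlinarith [mul_le_mul_of_nonneg_right hqL (sub_pos.2 hrρ).le]
    _ = ∫⁻ j, tiltedParabola β L (y + j) ∂massMeasure a := by
        rw [ofReal_integral_eq_lintegral_ofReal hg_int.pos_part
          (ae_of_all _ fun j => le_max_right _ _)]
        refine lintegral_congr fun j => ?_
        simp only [ENNReal.ofReal_max, ENNReal.ofReal_zero]
        exact max_eq_left zero_le
    _ = ∑' j : ℤ, a j * tiltedParabola β L (y + j) := lintegral_massMeasure a _

end Minimizer

end KilledWalk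

namespace KilledWalk

open Filter Topology

/-! ### Toeplitz matrices on the half-line -/

section Toeplitz

/-- The Toeplitz matrix on `ℕ+` with symbol `a`. -/
def toeplitz (a : ℤ → ℝ≥0∞) : ℕ+ → ℕ+ → ℝ≥0∞ := fun y y' => a ((y' : ℤ) - y)

/-- Killing discards the terms with `y + j ≤ 0`. -/
theorem tsum_toeplitz_mul_le (a F : ℤ → ℝ≥0∞) (y : ℕ+) :
    ∑' y' : ℕ+, toeplitz a y y' * F y' ≤ ∑' j : ℤ, a j * F (y + j) := by
  have hinj : Function.Injective fun y' : ℕ+ => (y' : ℤ) - y := fun b c h => by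
    have h' : (b : ℤ) = c := by simpa using h
    exact_mod_cast h'
  refine le_trans (le_of_eq ?_) (ENNReal.tsum_comp_le_tsum_of_injective hinj _)
  refine tsum_congr fun y' => ?_
  simp [toeplitz]

theorem tsum_toeplitz_mul_eq (a : ℤ → ℝ≥0∞) {F : ℤ → ℝ≥0∞} (hF : ∀ y ≤ 0, F y = 0) (y : ℕ+) :
    ∑' y' : ℕ+, toeplitz a y y' * F y' = ∑' j : ℤ, a j * F (y + j) := by
  have hinj : Function.Injective fun y' : ℕ+ => (y' : ℤ) - y := fun b c h => by
    have h' : (b : ℤ) = c := by simpa using h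
    exact_mod_cast h'
  rw [← hinj.tsum_eq]
  · refine tsum_congr fun y' => ?_
    simp [toeplitz]
  · intro j hj
    have h1 : 0 < (y : ℤ) + j := by
      by_contra! h
      exact hj (by simp [hF _ h])
    refine ⟨⟨((y : ℤ) + j).toNat, by omega⟩, ?_⟩
    simp only [PNat.mk_coe]
    omega

/-- Upward steps never go below the starting point, so the path stays positive. -/
theorem exists_matPow_toeplitz_of_nonneg {a : ℤ → ℝ≥0∞} {p : ℤ}
    (hp : p ∈ AddSubmonoid.closure {j : ℤ | a j ≠ 0 ∧ 0 ≤ j}) :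
    0 ≤ p ∧ ∀ y y' : ℕ+, (y' : ℤ) = y + p → ∃ n, 0 < matPow (toeplitz a) n y y' := by
  induction hp using AddSubmonoid.closure_induction with
  | mem j hj =>
    refine ⟨hj.2, fun y y' h => ⟨1, ?_⟩⟩
    rw [matPow_one, toeplitz, h, add_sub_cancel_left]
    exact pos_iff_ne_zero.2 hj.1
  | zero =>
    refine ⟨le_rfl, fun y y' h => ⟨0, ?_⟩⟩
    obtain rfl : y' = y := by
      have : (y' : ℤ) = y := by simpa using h
      exact_mod_cast this
    simp [matPow_zero_self]
  | add p q _ _ ihp ihq =>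
    refine ⟨add_nonneg ihp.1 ihq.1, fun y y' h => ?_⟩
    have hy := y.pos
    have hp := ihp.1
    let v : ℕ+ := ⟨((y : ℤ) + p).toNat, by omega⟩
    have hv : (v : ℤ) = y + p := by
      simp only [v, PNat.mk_coe]
      omega
    obtain ⟨m, hm⟩ := ihp.2 y v hv
    obtain ⟨n, hn⟩ := ihq.2 v y' (by rw [h, hv]; ring)
    exact ⟨m + n, (ENNReal.mul_pos hm.ne' hn.ne').trans_le (matPow_mul_le _ m n y v y')⟩

/-- Downward steps never go below the endpoint before reaching it, and the endpoint is positive. -/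
theorem exists_matPow_toeplitz_of_nonpos {a : ℤ → ℝ≥0∞} {p : ℤ}
    (hp : p ∈ AddSubmonoid.closure {j : ℤ | a j ≠ 0 ∧ j ≤ 0}) :
    p ≤ 0 ∧ ∀ y y' : ℕ+, (y' : ℤ) = y + p → ∃ n, 0 < matPow (toeplitz a) n y y' := by
  induction hp using AddSubmonoid.closure_induction with
  | mem j hj =>
    refine ⟨hj.2, fun y y' h => ⟨1, ?_⟩⟩
    rw [matPow_one, toeplitz, h, add_sub_cancel_left]
    exact pos_iff_ne_zero.2 hj.1
  | zero =>
    refine ⟨le_rfl, fun y y' h => ⟨0, ?_⟩⟩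
    obtain rfl : y' = y := by
      have : (y' : ℤ) = y := by simpa using h
      exact_mod_cast this
    simp [matPow_zero_self]
  | add p q _ _ ihp ihq =>
    refine ⟨add_nonpos ihp.1 ihq.1, fun y y' h => ?_⟩
    have hy' := y'.pos
    have hq := ihq.1
    let v : ℕ+ := ⟨((y : ℤ) + p).toNat, by omega⟩
    have hv : (v : ℤ) = y + p := by
      simp only [v, PNat.mk_coe]
      omega
    obtain ⟨m, hm⟩ := ihp.2 y v hv
    obtain ⟨n, hn⟩ := ihq.2 v y' (by rw [h, hv]; ring)
    exact ⟨m + n, (ENNReal.mul_pos hm.ne' hn.ne').trans_le (matPow_mul_le _ m n y v y')⟩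

/-- A path in `ℤ` between two positive points can be reordered, taking the nonnegative steps first,
so that it stays positive. -/
theorem isIrreducible_toeplitz {a : ℤ → ℝ≥0∞}
    (ha : AddSubmonoid.closure {j : ℤ | a j ≠ 0} = ⊤) : IsIrreducible (toeplitz a) := by
  intro y y'
  have hset : {j : ℤ | a j ≠ 0} = {j : ℤ | a j ≠ 0 ∧ 0 ≤ j} ∪ {j : ℤ | a j ≠ 0 ∧ j ≤ 0} := by
    ext j
    have := le_total 0 j
    simp only [Set.mem_ofPred_eq, Set.mem_union]
    tauto
  have hmem : (y' : ℤ) - y ∈ AddSubmonoid.closure {j : ℤ | a j ≠ 0} := ha ▸ AddSubmonoid.mem_top _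
  rw [hset, AddSubmonoid.closure_union, AddSubmonoid.mem_sup] at hmem
  obtain ⟨p, hp, q, hq, hpq⟩ := hmem
  obtain ⟨hp0, hp⟩ := exists_matPow_toeplitz_of_nonneg hp
  obtain ⟨-, hq⟩ := exists_matPow_toeplitz_of_nonpos hq
  have hy := y.pos
  let v : ℕ+ := ⟨((y : ℤ) + p).toNat, by omega⟩
  have hv : (v : ℤ) = y + p := by
    simp only [v, PNat.mk_coe]
    omega
  obtain ⟨m, hm⟩ := hp y v hv
  obtain ⟨n, hn⟩ := hq v y' (by rw [hv]; linarith)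
  exact ⟨m + n, (ENNReal.mul_pos hm.ne' hn.ne').trans_le (matPow_mul_le _ m n y v y')⟩

theorem exists_pos_mem_of_closure_eq_top {G : Set ℤ} (hG : AddSubmonoid.closure G = ⊤) :
    ∃ u ∈ G, 0 < u := by
  by_contra! h
  have h1 : ∀ j ∈ AddSubmonoid.closure G, j ≤ 0 := fun j hj =>
    AddSubmonoid.closure_induction h le_rfl (fun _ _ _ _ => add_nonpos) hj
  have h2 := h1 1 (hG ▸ AddSubmonoid.mem_top 1)
  omega

theorem exists_neg_mem_of_closure_eq_top {G : Set ℤ} (hG : AddSubmonoid.closure G = ⊤) :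
    ∃ d ∈ G, d < 0 := by
  by_contra! h
  have h1 : AddSubmonoid.closure G ≤ AddSubmonoid.nonneg ℤ := AddSubmonoid.closure_le.2 h
  rw [hG] at h1
  have h2 : (0 : ℤ) ≤ -1 := h1 (AddSubmonoid.mem_top (-1))
  omega

theorem logSpectralRadius_toeplitz {a : ℤ → ℝ≥0∞}
    (hfin : ∀ β : ℝ, ∑' j : ℤ, a j * ENNReal.ofReal (Real.exp (β * j)) ≠ ∞)
    (ha : AddSubmonoid.closure {j : ℤ | a j ≠ 0} = ⊤) (y y' : ℕ+) :
    logSpectralRadius (toeplitz a) y y' =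
      ⨅ β : ℝ, ENNReal.log (∑' j : ℤ, a j * ENNReal.ofReal (Real.exp (β * j))) := by
  refine le_antisymm (le_iInf fun β => ?_) ?_
  · refine logSpectralRadius_le_log (f := fun y : ℕ+ => ENNReal.ofReal (Real.exp (β * (y : ℤ))))
      (fun s => ?_) ENNReal.ofReal_ne_top (by simp [Real.exp_pos]) ENNReal.ofReal_ne_top
    refine (tsum_toeplitz_mul_le a (fun j => ENNReal.ofReal (Real.exp (β * j))) s).trans ?_
    rw [← ENNReal.tsum_mul_right]
    refine ENNReal.tsum_le_tsum fun j => ?_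
    push_cast
    rw [mul_add, Real.exp_add, ENNReal.ofReal_mul (Real.exp_pos _).le, mul_assoc, mul_comm
      (ENNReal.ofReal (Real.exp (β * j)))]
  obtain ⟨u, hau, hu⟩ := exists_pos_mem_of_closure_eq_top ha
  obtain ⟨d, had, hd⟩ := exists_neg_mem_of_closure_eq_top ha
  obtain ⟨β, hβ⟩ := exists_tilted_mean_eq_zero hfin hu hd hau had
  refine iInf_le_of_le β ?_
  rw [← EReal.log_exp (logSpectralRadius _ _ _), ENNReal.log_le_log_iff]
  refine le_of_forall_lt_imp_le_of_dense fun r hr => ?_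
  -- The test-function bound divides by powers of `r`, hence the separate case.
  rcases eq_or_ne r 0 with rfl | hr0
  · exact zero_le
  rw [← ENNReal.log_le_log_iff, EReal.log_exp]
  obtain ⟨L, hL, h⟩ := exists_mul_tiltedParabola_le hfin hβ hr
  refine log_le_logSpectralRadius (isIrreducible_toeplitz ha)
    (f := fun y : ℕ+ => tiltedParabola β L (y : ℤ)) (s₀ := 1) ?_ (fun s => ENNReal.ofReal_ne_top)
    ?_ hr0 (hr.trans_le le_top).ne (fun s => ?_) y y'
  · refine (Set.finite_Iio (⟨2 * L, by omega⟩ : ℕ+)).subset fun s hs => ?_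
    by_contra hs'
    refine hs (tiltedParabola_eq_zero (Or.inr ?_))
    have : 2 * L ≤ (s : ℕ) := by
      rw [Set.mem_Iio, not_lt] at hs'
      exact hs'
    exact_mod_cast this
  · have hL' : (1 : ℝ) ≤ L := by exact_mod_cast hL
    refine (ENNReal.ofReal_pos.2 (mul_pos (Real.exp_pos _) ?_)).ne'
    simp
    linarith
  · rw [tsum_toeplitz_mul_eq a (fun y hy => tiltedParabola_eq_zero (Or.inl hy))]
    exact h s

end Toeplitz

/-! ### Reduction of the killed walk to the Toeplitz case -/

section Walk

variable {k : ℕ} (μ : PMF ((Fin k → ℤ) × ℤ)) (α : Fin k → ℝ)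

/-- The mass of the steps of the last coordinate under the weight `exp (α ⬝ x)`. -/
noncomputable def weightedStep (j : ℤ) : ℝ≥0∞ :=
  ∑' x : Fin k → ℤ, μ (x, j) * ENNReal.ofReal (Real.exp (∑ i, α i * (x i : ℝ)))

theorem feynmanKac_killedWalk :
    feynmanKac (killedWalk μ) α = toeplitz (weightedStep μ α) := by
  funext y y'
  simp [feynmanKac, killedWalk, walk, toeplitz, weightedStep]

theorem jumpGen_eq_tsum_weightedStep (β : ℝ) :
    jumpGen μ α β = ∑' j : ℤ, weightedStep μ α j * ENNReal.ofReal (Real.exp (β * j)) := by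
  rw [jumpGen, ENNReal.tsum_prod', ENNReal.tsum_comm]
  refine tsum_congr fun j => ?_
  rw [weightedStep, ← ENNReal.tsum_mul_right]
  refine tsum_congr fun x => ?_
  rw [Real.exp_add, ENNReal.ofReal_mul (Real.exp_pos _).le, mul_assoc]

/-- Exponential weights are positive, so no possible step is lost. -/
theorem weightedStep_ne_zero {z : (Fin k → ℤ) × ℤ} (hz : μ z ≠ 0) :
    weightedStep μ α z.2 ≠ 0 := by
  intro h
  rw [weightedStep, ENNReal.tsum_eq_zero] at h
  exact mul_ne_zero hz (by simp [Real.exp_pos]) (h z.1)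

theorem snd_sub_mem_closure_of_matPow_walk {n : ℕ} {s t : (Fin k → ℤ) × ℤ}
    (h : matPow (walk μ) n s t ≠ 0) :
    t.2 - s.2 ∈ AddSubmonoid.closure {j : ℤ | weightedStep μ α j ≠ 0} := by
  classical
  induction n generalizing t with
  | zero =>
    have : s = t := by
      by_contra hst
      exact h (by simp [matPow, hst])
    simp [this]
  | succ n ih =>
    simp only [matPow, ne_eq, ENNReal.tsum_eq_zero, not_forall] at h
    obtain ⟨u, hu⟩ := h
    have h1 := ih (left_ne_zero_of_mul hu)
    have h2 : weightedStep μ α (t - u).2 ≠ 0 :=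
      weightedStep_ne_zero μ α (right_ne_zero_of_mul hu)
    have h3 := add_mem h1 (AddSubmonoid.subset_closure h2)
    rwa [Prod.snd_sub, sub_add_sub_comm, add_comm u.2, add_sub_add_right_eq_sub] at h3

/-- The last coordinates of the steps along a path from `(0, 0)` to `(0, j)` sum to `j`. -/
theorem closure_weightedStep_eq_top (h : IsIrreducible (walk μ)) :
    AddSubmonoid.closure {j : ℤ | weightedStep μ α j ≠ 0} = ⊤ := by
  refine eq_top_iff.2 fun j _ => ?_
  obtain ⟨n, hn⟩ := h (0, 0) (0, j)
  simpa using snd_sub_mem_closure_of_matPow_walk μ α hn.ne'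

end Walk

end KilledWalk

theorem lemma5p1 (k : ℕ) (μ : PMF ((Fin k → ℤ) × ℤ)) (hA : KilledWalk.Hypotheses μ)
    (α : Fin k → ℝ) (y y' : ℕ+) :
    KilledWalk.logSpectralRadius
        (KilledWalk.feynmanKac (KilledWalk.killedWalk μ) α) y y' =
      ⨅ β : ℝ, ENNReal.log (KilledWalk.jumpGen μ α β) := by
  simp only [KilledWalk.feynmanKac_killedWalk, KilledWalk.jumpGen_eq_tsum_weightedStep]
  refine KilledWalk.logSpectralRadius_toeplitz (fun β => ?_)
    (KilledWalk.closure_weightedStep_eq_top μ α hA.irreducible) y y'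
  rw [← KilledWalk.jumpGen_eq_tsum_weightedStep]
  exact hA.finite α β
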